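/- Let $N$ be a lattice with dual lattice $M=\mathrm{Hom}(N,\mathbb{Z})$, let $\Sigma_Y$ be a complete fan in $N_{\mathbb{Q}}=N\otimes\mathbb{Q}$, and let $Y$ be the corresponding complete toric variety. Let the set $\Sigma_Y(1)$ of rays be partitioned into (possibly empty) subsets $E_1,\ldots,E_r$ and $F$, where $r\geq 0$, and let $D_i=\sum_{\rho\in E_i}D_\rho$ and $D_F=\sum_{\rho\in F}D_\rho$ be the corresponding torus-invariant divisors. Suppose that the partition is a *Fano nef partition*, that is, $D_F$ is an ample ($\mathbb{Q}$-Cartier) divisor, and each $D_i$ is a nef Cartier divisor. Here a torus-invariant divisor $D=\sum_\rho a_\rho D_\rho$ is ($\mathbb{Q}$-)Cartier if there is a function $\phi_D$ on $N_{\mathbb{Q}}$ which takes the value $a_\rho$ on the primitive generator of each ray $\rho$ and is linear on every cone $\sigma$ of $\Sigma_Y$, given there by an element of $M$ (respectively of $M\otimes\mathbb{Q}$); it is nef if $\phi_D$ is convex, and ample if $\phi_D$ is strictly convex with respect to $\Sigma_Y$, i.e. $\phi_D$ is convex and, for every maximal cone $\sigma$, it agrees only on $\sigma$ with the linear function on $N_{\mathbb{Q}}$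 extending $\phi_D|_\sigma$. Then the cone generated by the rays in $\bigcup_{i=1}^r E_i$ belongs to $\Sigma_Y$, and it is a Gorenstein cone: there is $m\in M$ with $\langle m,u\rangle=1$ for the primitive lattice generator $u$ of each of its one-dimensional faces. -/

import Mathlib

open scoped TensorProduct

/-- The rational vector space `N_ℚ = ℚ ⊗ N` of a lattice `N`. -/
abbrev LatticeQ (N : Type*) [AddCommGroup N] : Type _ := ℚ ⊗[ℤ] N

/-- The inclusion `N → N_ℚ`. -/
def latticeIncl {N : Type*} [AddCommGroup N] (u : N) : LatticeQ N := (1 : ℚ) ⊗ₜ[ℤ] u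

/-- The cone in `N_ℚ` generated by a set of lattice vectors. -/
def latticeCone {N : Type*} [AddCommGroup N] (A : Set N) : PointedCone ℚ (LatticeQ N) :=
  PointedCone.hull ℚ (latticeIncl '' A)

/-- A lattice vector is primitive if it is not a multiple of another one by a natural number
other than `1` (in particular it is nonzero). -/
def IsPrimitiveVector {N : Type*} [AddCommGroup N] (u : N) : Prop :=
  ∀ (k : ℕ) (w : N), u = k • w → k = 1

/-- A fan in `N_ℚ`: a finite nonempty collection of strongly convex rational polyhedral cones,
closed under taking faces, any two of which meet in a common face. (A finitely generated cone
in `N_ℚ` is automatically generated by lattice vectors.) -/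
structure ToricFan (N : Type*) [AddCommGroup N] where
  cones : Set (PointedCone ℚ (LatticeQ N))
  finite : cones.Finite
  nonempty : cones.Nonempty
  polyhedral : ∀ σ ∈ cones, σ.FG
  stronglyConvex : ∀ σ ∈ cones, σ.toConvexCone.Salient
  face_mem : ∀ σ ∈ cones, ∀ τ : PointedCone ℚ (LatticeQ N), τ.IsFaceOf σ → τ ∈ cones
  inter_face : ∀ σ ∈ cones, ∀ τ ∈ cones, (σ ⊓ τ).IsFaceOf σ ∧ (σ ⊓ τ).IsFaceOf τ

namespace ToricFan

/-- The fan is complete (equivalently, its toric variety is complete). -/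
def IsComplete {N : Type*} [AddCommGroup N] (S : ToricFan N) : Prop :=
  ∀ x : LatticeQ N, ∃ σ ∈ S.cones, x ∈ σ

/-- The rays of the fan, each represented by its primitive lattice generator. -/
def rays {N : Type*} [AddCommGroup N] (S : ToricFan N) : Set N :=
  {u | IsPrimitiveVector u ∧ latticeCone {u} ∈ S.cones}

/-- A torus-invariant Weil divisor `∑ a_ρ D_ρ` on the toric variety of the fan: an integer-valued
function `ρ ↦ a_ρ` on the set of rays. -/
abbrev WeilDivisor {N : Type*} [AddCommGroup N] (S : ToricFan N) : Type _ := S.rays → ℤ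

open Classical in
/-- The torus-invariant divisor `∑_{ρ ∈ A} D_ρ` corresponding to a set `A` of rays. -/
noncomputable def divisorOf {N : Type*} [AddCommGroup N] (S : ToricFan N) (A : Set S.rays) :
    S.WeilDivisor :=
  fun ρ => if ρ ∈ A then 1 else 0

/-- The divisor is Cartier: on the affine chart of every cone `σ` it is given by a character
`m_σ ∈ M = Hom(N, ℤ)`. -/
def IsCartier {N : Type*} [AddCommGroup N] (S : ToricFan N) (D : S.WeilDivisor) : Prop :=
  ∀ σ ∈ S.cones, ∃ m : N →ₗ[ℤ] ℤ, ∀ ρ : S.rays, latticeIncl (ρ : N) ∈ σ → m ρ = D ρ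

/-- `φ` is the piecewise linear function of the divisor `D = ∑ a_ρ D_ρ` on a complete fan: it is
linear on every cone of the fan, and its value on the primitive generator of `ρ` is `a_ρ`. Such a
function exists if and only if `D` is `ℚ`-Cartier. -/
structure IsPLFunction {N : Type*} [AddCommGroup N] (S : ToricFan N) (D : S.WeilDivisor)
    (φ : LatticeQ N → ℚ) : Prop where
  linear_on : ∀ σ ∈ S.cones, ∃ m : LatticeQ N →ₗ[ℚ] ℚ, ∀ x ∈ σ, φ x = m x
  value : ∀ ρ : S.rays, φ (latticeIncl (ρ : N)) = D ρ

/-- The divisor `D` (on a complete toric variety) is nef: it is Cartier and its piecewise linear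
function is convex. -/
def IsNef {N : Type*} [AddCommGroup N] (S : ToricFan N) (D : S.WeilDivisor) : Prop :=
  S.IsCartier D ∧ ∃ φ : LatticeQ N → ℚ, S.IsPLFunction D φ ∧ ConvexOn ℚ Set.univ φ

/-- The (`ℚ`-Cartier) divisor `D` on a complete toric variety is ample: its piecewise linear
function `φ` is strictly convex with respect to the fan, that is, it is convex, and for every
maximal cone `σ` it agrees only on `σ` with the linear function extending its restriction
to `σ`. -/
def IsAmple {N : Type*} [AddCommGroup N] (S : ToricFan N) (D : S.WeilDivisor) : Prop :=
  ∃ φ : LatticeQ N → ℚ, S.IsPLFunction D φ ∧ ConvexOn ℚ Set.univ φ ∧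
    ∀ σ, Maximal (· ∈ S.cones) σ → ∀ m : LatticeQ N →ₗ[ℚ] ℚ, (∀ x ∈ σ, φ x = m x) →
      ∀ x, φ x = m x → x ∈ σ

/-- A Fano nef partition of the rays of the fan into `E_1, …, E_r` and `F`. -/
structure IsFanoNefPartition {N : Type*} [AddCommGroup N] (S : ToricFan N) {r : ℕ}
    (E : Fin r → Set S.rays) (F : Set S.rays) : Prop where
  disjoint_E : ∀ i j, i ≠ j → Disjoint (E i) (E j)
  disjoint_F : ∀ i, Disjoint (E i) F
  cover : (⋃ i, E i) ∪ F = Set.univ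
  ample_F : S.IsAmple (S.divisorOf F)
  nef_E : ∀ i, S.IsNef (S.divisorOf (E i))

end ToricFan

/-- A cone in `N_ℚ` is Gorenstein if it is a strongly convex rational polyhedral cone and there is
`m ∈ M = Hom(N, ℤ)` taking the value `1` on the primitive generator of each of its
one-dimensional faces. -/
def IsGorensteinCone {N : Type*} [AddCommGroup N] (σ : PointedCone ℚ (LatticeQ N)) : Prop :=
  σ.FG ∧ σ.toConvexCone.Salient ∧
    ∃ m : N →ₗ[ℤ] ℤ, ∀ u : N, IsPrimitiveVector u → (latticeCone {u}).IsFaceOf σ → m u = 1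

/-! Let `φ` be the function of `D_F` and `C` the cone over the rays of the `E i`. As `D_F` is
effective, `φ ≥ 0`, and by convexity `φ` vanishes exactly on `C`. Let `x` be the sum of generators
of `C`, and let `σ` be a full-dimensional cone of the fan with `φ = m` on `σ` that contains `n • x +
v` for infinitely many `n`. Convexity gives `m ≤ φ` everywhere, so `m ≤ 0` on the generators, while
`φ ≥ 0` on `σ` forces `m x ≥ 0`. Hence `m` and `φ` both vanish on the generators, and strict
convexity puts `C` inside `σ`, where it is the face `φ = 0`
(`latticeCone_mem_cones_of_isPLFunction`). On `C`, the Cartier data of the `D_i` add up to the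
required element of `M`. -/

namespace PointedCone

/-! ### Extremal rays and finite covers by cones. -/

variable {V : Type*} [AddCommGroup V] [Module ℚ V]

theorem exists_irredundant_generators (A : Finset V) :
    ∃ B : Set V, hull ℚ B = hull ℚ (A : Set V) ∧ ∀ b ∈ B, b ∉ hull ℚ (B \ {b}) := by
  classical
  induction hn : A.card using Nat.strong_induction_on generalizing A with
  | _ n ih =>
    by_cases h : ∀ b ∈ (A : Set V), b ∉ hull ℚ ((A : Set V) \ {b})
    · exact ⟨A, rfl, h⟩
    · push Not at h
      obtain ⟨b, hb, hbA⟩ := h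
      obtain ⟨B, hB, hirr⟩ := ih _ (hn ▸ Finset.card_erase_lt_of_mem hb) (A.erase b) rfl
      refine ⟨B, ?_, hirr⟩
      rw [hB, Finset.coe_erase]
      refine le_antisymm (Submodule.span_mono Set.sdiff_subset) (Submodule.span_le.2 fun x hx => ?_)
      by_cases hxb : x = b
      · exact hxb ▸ hbA
      · exact Submodule.subset_span ⟨hx, hxb⟩

theorem mem_hull_singleton {b x : V} : x ∈ hull ℚ {b} ↔ ∃ c : ℚ, 0 ≤ c ∧ c • b = x := by
  rw [hull, Submodule.mem_span_singleton]
  exact ⟨fun ⟨c, hc⟩ => ⟨c.1, c.2, hc⟩, fun ⟨c, h, hc⟩ => ⟨⟨c, h⟩, hc⟩⟩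

theorem hull_singleton_smul {b : V} {c : ℚ} (hc : 0 < c) : hull ℚ {c • b} = hull ℚ {b} := by
  ext x
  simp only [mem_hull_singleton]
  constructor
  · rintro ⟨d, hd, rfl⟩
    exact ⟨d * c, by positivity, by rw [mul_smul]⟩
  · rintro ⟨d, hd, rfl⟩
    exact ⟨d / c, by positivity, by rw [smul_smul, div_mul_cancel₀ _ hc.ne']⟩

/-- In a salient cone, a generator that is not redundant spans an extremal ray. -/
theorem hull_singleton_isFaceOf_hull {B : Set V} (hB : (hull ℚ B).toConvexCone.Salient) {b : V}
    (hb : b ∈ B) (hirr : b ∉ hull ℚ (B \ {b})) : (hull ℚ {b}).IsFaceOf (hull ℚ B) := by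
  have hins : ∀ x ∈ hull ℚ B, ∃ c : ℚ, 0 ≤ c ∧ ∃ z ∈ hull ℚ (B \ {b}), x = c • b + z := by
    intro x hx
    rw [← Set.insert_sdiff_self_of_mem hb] at hx
    obtain ⟨c, z, hz, h⟩ := Submodule.mem_span_insert.1 hx
    exact ⟨c.1, c.2, z, hz, h⟩
  have hle : hull ℚ (B \ {b}) ≤ hull ℚ B := Submodule.span_mono Set.sdiff_subset
  have hbB : b ∈ hull ℚ B := Submodule.subset_span hb
  refine ⟨Submodule.span_mono (by simpa using hb), ?_⟩
  intro x y a hx hy ha hxy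
  obtain ⟨α, hα, x', hx', rfl⟩ := hins x hx
  obtain ⟨β, hβ, y', hy', rfl⟩ := hins y hy
  obtain ⟨γ, hγ, h⟩ := mem_hull_singleton.1 hxy
  have key : (γ - a * α - β) • b = a • x' + y' := by
    rw [sub_smul, sub_smul, h, mul_smul]; module
  -- A positive coefficient would make `b` redundant; otherwise `-(a • x')` lies in the cone, and
  -- salience kills `x'`.
  rcases lt_or_ge 0 (γ - a * α - β) with hδ | hδ
  · refine absurd ((smul_mem_iff _ hδ).1 ?_) hirr
    rw [key]
    exact add_mem (smul_mem _ ha.le hx') hy'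
  · have h0 : x' = 0 := by
      by_contra hne
      refine hB (a • x') (smul_mem _ ha.le (hle hx')) (smul_ne_zero ha.ne' hne) ?_
      have : -(a • x') = y' + (-(γ - a * α - β)) • b := by rw [neg_smul, key]; module
      rw [this]
      exact add_mem (hle hy') (smul_mem _ (neg_nonneg.2 hδ) hbB)
    rw [h0, add_zero]
    exact mem_hull_singleton.2 ⟨α, hα, rfl⟩

/-- Finitely many cones that cover the space include, for each `x`, one that spans the space and
contains arbitrarily large multiples of `x`, up to a fixed translation. -/
theorem exists_spanning_of_finite_cover {C : Set (PointedCone ℚ V)} (hC : C.Finite)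
    (hcov : ∀ x : V, ∃ σ ∈ C, x ∈ σ) (x : V) :
    ∃ σ ∈ C, Submodule.span ℚ (σ : Set V) = ⊤ ∧ ∃ v : V,
      {n : ℕ | (n : ℚ) • x + v ∈ σ}.Infinite := by
  classical
  let T : Set (Submodule ℚ V) := (fun σ : PointedCone ℚ V => Submodule.span ℚ (σ : Set V)) '' C
  have hT : (T \ {⊤}).Finite := (hC.image _).sdiff
  -- Over an infinite field, finitely many proper subspaces do not cover the space.
  obtain ⟨v, hv⟩ : ∃ v : V, ∀ σ ∈ C, Submodule.span ℚ (σ : Set V) ≠ ⊤ →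
      v ∉ Submodule.span ℚ (σ : Set V) := by
    have h := Subspace.biUnion_ne_univ_of_top_notMem (s := hT.toFinset) (by simp)
    obtain ⟨v, hv⟩ := (Set.ne_univ_iff_exists_notMem _).1 h
    refine ⟨v, fun σ hσ hne hvσ => hv ?_⟩
    simp only [Set.mem_iUnion]
    exact ⟨_, by simpa using ⟨⟨σ, hσ, rfl⟩, hne⟩, hvσ⟩
  choose f hfC hf using fun n : ℕ => hcov ((n : ℚ) • x + v)
  have := hC.to_subtype
  obtain ⟨⟨σ, hσ⟩, hinf⟩ := Finite.exists_infinite_fiber (fun n => (⟨f n, hfC n⟩ : C))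
  have hinf' : {n : ℕ | (n : ℚ) • x + v ∈ σ}.Infinite := by
    refine (Set.infinite_coe_iff.1 hinf).mono fun n hn => ?_
    have : f n = σ := congrArg Subtype.val hn
    exact this ▸ hf n
  refine ⟨σ, hσ, ?_, v, hinf'⟩
  by_contra hne
  refine hv σ hσ hne ?_
  obtain ⟨n, hn⟩ := hinf'.nonempty
  obtain ⟨k, hk, hnk⟩ := hinf'.exists_gt n
  have h1 : (n : ℚ) • x + v ∈ Submodule.span ℚ (σ : Set V) := Submodule.subset_span hn
  have h2 : (k : ℚ) • x + v ∈ Submodule.span ℚ (σ : Set V) := Submodule.subset_span hk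
  have hkn : (k : ℚ) - n ≠ 0 := sub_ne_zero.2 (by exact_mod_cast hnk.ne')
  -- Two points of the line `n • x + v` in a proper span would put `x`, hence `v`, in it.
  have h3 : x ∈ Submodule.span ℚ (σ : Set V) := by
    refine (Submodule.smul_mem_iff _ hkn).1 ?_
    convert sub_mem h2 h1 using 1
    module
  simpa using sub_mem h1 (Submodule.smul_mem _ (n : ℚ) h3)

theorem exists_sub_eq_of_span_eq_top {σ : PointedCone ℚ V}
    (h : Submodule.span ℚ (σ : Set V) = ⊤) (z : V) : ∃ a ∈ σ, ∃ b ∈ σ, z = a - b := by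
  have hz : z ∈ Submodule.span ℚ (σ : Set V) := h ▸ Submodule.mem_top
  induction hz using Submodule.span_induction with
  | mem x hx => exact ⟨x, hx, 0, zero_mem _, by simp⟩
  | zero => exact ⟨0, zero_mem _, 0, zero_mem _, by simp⟩
  | add x y _ _ hx hy =>
    obtain ⟨a, ha, b, hb, rfl⟩ := hx
    obtain ⟨c, hc, d, hd, rfl⟩ := hy
    exact ⟨a + c, add_mem ha hc, b + d, add_mem hb hd, by abel⟩
  | smul c x _ hx =>
    obtain ⟨a, ha, b, hb, rfl⟩ := hx
    rcases le_total 0 c with hc | hc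
    · exact ⟨c • a, smul_mem _ hc ha, c • b, smul_mem _ hc hb, smul_sub _ _ _⟩
    · exact ⟨(-c) • b, smul_mem _ (neg_nonneg.2 hc) hb, (-c) • a,
        smul_mem _ (neg_nonneg.2 hc) ha, by module⟩

end PointedCone

/-! ### Primitive lattice vectors. -/

section Lattice

variable {N : Type*} [AddCommGroup N]

theorem latticeIncl_nsmul (k : ℕ) (u : N) : latticeIncl (k • u) = (k : ℚ) • latticeIncl u := by
  rw [latticeIncl, latticeIncl, TensorProduct.tmul_smul, Nat.cast_smul_eq_nsmul]

theorem latticeIncl_zsmul (k : ℤ) (u : N) : latticeIncl (k • u) = (k : ℚ) • latticeIncl u := by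
  rw [latticeIncl, latticeIncl, TensorProduct.tmul_smul, Int.cast_smul_eq_zsmul]

theorem mem_latticeCone_singleton (u : N) : latticeIncl u ∈ latticeCone {u} :=
  Submodule.subset_span ⟨u, rfl, rfl⟩

theorem latticeCone_singleton (u : N) : latticeCone {u} = PointedCone.hull ℚ {latticeIncl u} := by
  rw [latticeCone, Set.image_singleton]

theorem exists_smul_eq_latticeIncl (x : LatticeQ N) :
    ∃ d : ℕ, 0 < d ∧ ∃ w : N, (d : ℚ) • x = latticeIncl w := by
  induction x using TensorProduct.induction_on with
  | zero => exact ⟨1, one_pos, 0, by simp [latticeIncl]⟩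
  | tmul q u =>
    refine ⟨q.den, q.den_pos, q.num • u, ?_⟩
    rw [latticeIncl_zsmul, latticeIncl, TensorProduct.smul_tmul', TensorProduct.smul_tmul',
      smul_eq_mul, smul_eq_mul, mul_one, Rat.den_mul_eq_num]
  | add x y hx hy =>
    obtain ⟨d, hd, w, hw⟩ := hx
    obtain ⟨e, he, z, hz⟩ := hy
    refine ⟨d * e, Nat.mul_pos hd he, e • w + d • z, ?_⟩
    have h : latticeIncl (e • w + d • z) = latticeIncl (e • w) + latticeIncl (d • z) :=
      TensorProduct.tmul_add _ _ _
    rw [h, latticeIncl_nsmul, latticeIncl_nsmul, ← hw, ← hz]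
    push_cast
    module

/-- Descent on the ℓ¹-norm in a basis: dividing by `k ≥ 2` strictly lowers it. -/
theorem exists_eq_nsmul_isPrimitiveVector [Module.Free ℤ N] [Module.Finite ℤ N] {w : N}
    (hw : w ≠ 0) : ∃ (k : ℕ) (u : N), 0 < k ∧ IsPrimitiveVector u ∧ w = k • u := by
  let b := Module.Free.chooseBasis ℤ N
  induction hn : ∑ i, (b.repr w i).natAbs using Nat.strong_induction_on generalizing w with
  | _ n ih =>
    by_cases h : IsPrimitiveVector w
    · exact ⟨1, w, one_pos, h, (one_smul _ _).symm⟩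
    · simp only [IsPrimitiveVector, not_forall] at h
      obtain ⟨k, w', rfl, hk1⟩ := h
      have hk0 : k ≠ 0 := by rintro rfl; simp at hw
      have hw' : w' ≠ 0 := by rintro rfl; simp at hw
      have hsum : ∑ i, (b.repr (k • w') i).natAbs = k * ∑ i, (b.repr w' i).natAbs := by
        rw [Finset.mul_sum]
        exact Finset.sum_congr rfl fun i _ => by simp [Int.natAbs_mul]
      have hpos : 0 < ∑ i, (b.repr w' i).natAbs := by
        rw [Nat.pos_iff_ne_zero]
        intro h0
        refine hw' (b.repr.map_eq_zero_iff.1 (Finsupp.ext fun i => ?_))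
        simpa using Finset.sum_eq_zero_iff.1 h0 i (Finset.mem_univ i)
      obtain ⟨j, u, hj, hu, rfl⟩ := ih _ (by rw [← hn, hsum]; nlinarith [show 2 ≤ k by omega]) hw' rfl
      exact ⟨k * j, u, Nat.mul_pos (Nat.pos_of_ne_zero hk0) hj, hu, (mul_smul _ _ _).symm⟩

theorem exists_isPrimitiveVector_smul [Module.Free ℤ N] [Module.Finite ℤ N] {x : LatticeQ N}
    (hx : x ≠ 0) : ∃ (c : ℚ) (u : N), 0 < c ∧ IsPrimitiveVector u ∧ x = c • latticeIncl u := by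
  obtain ⟨d, hd, w, hw⟩ := exists_smul_eq_latticeIncl x
  have hd' : (0 : ℚ) < d := by exact_mod_cast hd
  have hw0 : w ≠ 0 := by
    rintro rfl
    exact smul_ne_zero hd'.ne' hx (by rw [hw]; exact TensorProduct.tmul_zero _ _)
  obtain ⟨k, u, hk, hu, rfl⟩ := exists_eq_nsmul_isPrimitiveVector hw0
  refine ⟨(d : ℚ)⁻¹ * k, u, by positivity, hu, ?_⟩
  rw [mul_smul, ← latticeIncl_nsmul, ← hw, inv_smul_smul₀ hd'.ne']

end Lattice

/-! ### Piecewise linear functions on a fan. -/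

namespace ToricFan

variable {N : Type*} [AddCommGroup N] {S : ToricFan N}

/-- Every cone of a fan is generated by the rays of the fan that it contains. -/
theorem le_latticeCone_rays [Module.Free ℤ N] [Module.Finite ℤ N]
    {σ : PointedCone ℚ (LatticeQ N)} (hσ : σ ∈ S.cones) :
    σ ≤ latticeCone {u | u ∈ S.rays ∧ latticeIncl u ∈ σ} := by
  obtain ⟨A, hA⟩ := S.polyhedral σ hσ
  obtain ⟨B, hB, hirr⟩ := PointedCone.exists_irredundant_generators A
  have hBσ : PointedCone.hull ℚ B = σ := hB.trans hA
  refine hBσ.symm.le.trans (Submodule.span_le.2 fun b hb => ?_)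
  have hface : (PointedCone.hull ℚ {b}).IsFaceOf σ := by
    rw [← hBσ]
    refine PointedCone.hull_singleton_isFaceOf_hull ?_ hb (hirr b hb)
    rw [hBσ]
    exact S.stronglyConvex σ hσ
  have hb0 : b ≠ 0 := by
    rintro rfl
    exact hirr 0 hb (zero_mem _)
  obtain ⟨c, u, hc, hu, rfl⟩ := exists_isPrimitiveVector_smul hb0
  rw [PointedCone.hull_singleton_smul hc, ← latticeCone_singleton] at hface
  refine PointedCone.smul_mem _ hc.le (Submodule.subset_span ⟨u, ⟨⟨hu, ?_⟩, ?_⟩, rfl⟩)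
  · exact S.face_mem σ hσ _ hface
  · exact hface.le (mem_latticeCone_singleton u)

namespace IsPLFunction

variable {D : S.WeilDivisor} {φ : LatticeQ N → ℚ}

theorem map_smul (hφ : S.IsPLFunction D φ) (hS : S.IsComplete) {c : ℚ} (hc : 0 ≤ c)
    (x : LatticeQ N) : φ (c • x) = c * φ x := by
  obtain ⟨σ, hσ, hx⟩ := hS x
  obtain ⟨m, hm⟩ := hφ.linear_on σ hσ
  rw [hm _ (PointedCone.smul_mem _ hc hx), hm x hx, _root_.map_smul, smul_eq_mul]

theorem map_add_le (hφ : S.IsPLFunction D φ) (hS : S.IsComplete) (hconv : ConvexOn ℚ Set.univ φ)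
    (x y : LatticeQ N) : φ (x + y) ≤ φ x + φ y := by
  have h := hconv.2 (Set.mem_univ x) (Set.mem_univ y)
    (show (0 : ℚ) ≤ 1 / 2 by norm_num) (show (0 : ℚ) ≤ 1 / 2 by norm_num) (by norm_num)
  rw [← smul_add, hφ.map_smul hS (by norm_num), smul_eq_mul, smul_eq_mul] at h
  linarith

/-- A linear function that agrees with a convex piecewise linear function on a spanning cone of
the fan is bounded above by it. -/
theorem linear_le (hφ : S.IsPLFunction D φ) (hS : S.IsComplete) (hconv : ConvexOn ℚ Set.univ φ)
    {σ : PointedCone ℚ (LatticeQ N)} (hspan : Submodule.span ℚ (σ : Set (LatticeQ N)) = ⊤)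
    {m : LatticeQ N →ₗ[ℚ] ℚ} (hm : ∀ x ∈ σ, φ x = m x) (z : LatticeQ N) : m z ≤ φ z := by
  obtain ⟨a, ha, b, hb, rfl⟩ := PointedCone.exists_sub_eq_of_span_eq_top hspan z
  have h := hφ.map_add_le hS hconv (a - b) b
  rw [sub_add_cancel, hm a ha, hm b hb] at h
  rw [map_sub]
  linarith

/-- The piecewise linear function of an effective divisor is nonnegative, and it vanishes only on
the cone generated by the rays with coefficient zero. -/
theorem nonneg_and_mem_of_eq_zero [Module.Free ℤ N] [Module.Finite ℤ N]
    (hφ : S.IsPLFunction D φ) (hS : S.IsComplete) (hD : ∀ ρ, 0 ≤ D ρ) (x : LatticeQ N) :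
    0 ≤ φ x ∧ (φ x = 0 → x ∈ latticeCone ((↑) '' {ρ : S.rays | D ρ = 0} : Set N)) := by
  obtain ⟨σ, hσ, hx⟩ := hS x
  obtain ⟨m, hm⟩ := hφ.linear_on σ hσ
  rw [hm x hx]
  -- All generators used lie in `σ`, so the induction can run on the linear `m` in place of `φ`.
  have hx' := le_latticeCone_rays hσ hx
  clear hx
  rw [latticeCone, PointedCone.hull] at hx'
  induction hx' using Submodule.span_induction with
  | mem x hx =>
    obtain ⟨u, ⟨hu, huσ⟩, rfl⟩ := hx
    rw [← hm _ huσ, hφ.value ⟨u, hu⟩]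
    exact ⟨by exact_mod_cast hD _, fun h0 =>
      Submodule.subset_span ⟨u, ⟨⟨u, hu⟩, by exact_mod_cast h0, rfl⟩, rfl⟩⟩
  | zero => exact ⟨by simp, fun _ => zero_mem _⟩
  | add x y _ _ hx hy =>
    rw [map_add]
    refine ⟨add_nonneg hx.1 hy.1, fun h => ?_⟩
    obtain ⟨h1, h2⟩ := (add_eq_zero_iff_of_nonneg hx.1 hy.1).1 h
    exact add_mem (hx.2 h1) (hy.2 h2)
  | smul c x _ hx =>
    have hc : m (c • x) = (c : ℚ) * m x := m.map_smul (c : ℚ) x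
    rw [hc]
    refine ⟨mul_nonneg c.2 hx.1, fun h => ?_⟩
    rcases mul_eq_zero.1 h with h | h
    · rw [show c = 0 from Subtype.ext h, zero_smul]
      exact zero_mem _
    · exact Submodule.smul_mem _ _ (hx.2 h)

/-- Subadditivity bounds `φ` above by zero on sums of zeros, and `hnn` bounds it below. -/
theorem eq_zero_of_mem_latticeCone (hφ : S.IsPLFunction D φ) (hS : S.IsComplete)
    (hconv : ConvexOn ℚ Set.univ φ) (hnn : ∀ x, 0 ≤ φ x) {x : LatticeQ N}
    (hx : x ∈ latticeCone ((↑) '' {ρ : S.rays | D ρ = 0} : Set N)) : φ x = 0 := by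
  rw [latticeCone, PointedCone.hull] at hx
  induction hx using Submodule.span_induction with
  | mem x hx =>
    obtain ⟨_, ⟨ρ, hρ, rfl⟩, rfl⟩ := hx
    rw [hφ.value, show D ρ = 0 from hρ, Int.cast_zero]
  | zero => simpa using hφ.map_smul hS le_rfl 0
  | add x y _ _ hx hy =>
    have := hφ.map_add_le hS hconv x y
    exact le_antisymm (by linarith) (hnn _)
  | smul c x _ hx =>
    have hc : φ (c • x) = (c : ℚ) * φ x := hφ.map_smul hS c.2 x
    rw [hc, hx, mul_zero]

end IsPLFunction

/-! ### The zero cone of an effective ample divisor. -/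

/-- Finitely many elements of a set of rays suffice to represent all of its cones. -/
theorem exists_finset_rays (A : Set S.rays) : ∃ t : Finset S.rays, (t : Set S.rays) ⊆ A ∧
    ∀ ρ ∈ A, ∃ τ ∈ t, latticeCone {(ρ : N)} = latticeCone {(τ : N)} := by
  classical
  let f : S.rays → PointedCone ℚ (LatticeQ N) := fun ρ => latticeCone {(ρ : N)}
  have hfin : (f '' A).Finite := S.finite.subset (by rintro _ ⟨ρ, _, rfl⟩; exact ρ.2.2)
  obtain ⟨t, htA, ht⟩ := Finset.subset_set_image_iff.1 (hfin.coe_toFinset.subset)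
  refine ⟨t, htA, fun ρ hρ => ?_⟩
  have : f ρ ∈ t.image f := by rw [ht, Set.Finite.mem_toFinset]; exact ⟨ρ, hρ, rfl⟩
  obtain ⟨τ, hτ, h⟩ := Finset.mem_image.1 this
  exact ⟨τ, hτ, h.symm⟩

/-- For an effective ample divisor on a complete toric variety, the rays with coefficient zero
generate a cone of the fan. -/
theorem latticeCone_mem_cones_of_isPLFunction [Module.Free ℤ N] [Module.Finite ℤ N]
    (hS : S.IsComplete) {D : S.WeilDivisor} (hD : ∀ ρ, 0 ≤ D ρ) {φ : LatticeQ N → ℚ}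
    (hφ : S.IsPLFunction D φ) (hconv : ConvexOn ℚ Set.univ φ)
    (hstrict : ∀ σ, Maximal (· ∈ S.cones) σ → ∀ m : LatticeQ N →ₗ[ℚ] ℚ,
      (∀ x ∈ σ, φ x = m x) → ∀ x, φ x = m x → x ∈ σ) :
    latticeCone ((↑) '' {ρ : S.rays | D ρ = 0} : Set N) ∈ S.cones := by
  have hnn := fun x => (hφ.nonneg_and_mem_of_eq_zero hS hD x).1
  obtain ⟨t, htA, ht⟩ := exists_finset_rays {ρ : S.rays | D ρ = 0}
  have hzero : ∀ ρ ∈ t, φ (latticeIncl (ρ : N)) = 0 := fun ρ hρ => by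
    rw [hφ.value, show D ρ = 0 from htA hρ, Int.cast_zero]
  obtain ⟨σ₀, hσ₀, hspan₀, v, hv₀⟩ := PointedCone.exists_spanning_of_finite_cover S.finite hS
    (∑ ρ ∈ t, latticeIncl (ρ : N))
  -- Strict convexity speaks only of maximal cones; enlarging `σ₀` keeps its span and its points.
  obtain ⟨σ, hle, hmax⟩ := S.finite.exists_le_maximal hσ₀
  have hspan : Submodule.span ℚ (σ : Set (LatticeQ N)) = ⊤ :=
    top_unique (hspan₀ ▸ Submodule.span_mono hle)
  set x := ∑ ρ ∈ t, latticeIncl (ρ : N)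
  obtain ⟨m, hm⟩ := hφ.linear_on σ hmax.prop
  have hmle := hφ.linear_le hS hconv hspan hm
  have hmt : ∀ ρ ∈ t, m (latticeIncl (ρ : N)) ≤ 0 := fun ρ hρ => hzero ρ hρ ▸ hmle _
  have hmx : m x = ∑ ρ ∈ t, m (latticeIncl (ρ : N)) := map_sum m _ _
  have hx0 : m x = 0 := by
    by_contra hne
    have hneg : m x < 0 := lt_of_le_of_ne (hmx ▸ Finset.sum_nonpos hmt) hne
    -- Beyond this bound `n * m x + m v` is negative, although it is a value of `φ`.
    obtain ⟨k, hk⟩ := exists_nat_gt (m v / (-m x))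
    obtain ⟨n, hn, hkn⟩ := hv₀.exists_gt k
    have h1 := hnn ((n : ℚ) • x + v)
    rw [hm _ (hle hn), map_add, m.map_smul, smul_eq_mul] at h1
    rw [div_lt_iff₀ (by linarith)] at hk
    have : (k : ℚ) < n := by exact_mod_cast hkn
    nlinarith
  have htσ : ∀ ρ ∈ t, latticeIncl (ρ : N) ∈ σ := fun ρ hρ => by
    refine hstrict σ hmax m hm _ ?_
    rw [hzero ρ hρ, (Finset.sum_eq_zero_iff_of_nonpos hmt).1 (hmx ▸ hx0) ρ hρ]
  have hCσ : latticeCone ((↑) '' {ρ : S.rays | D ρ = 0} : Set N) ≤ σ := by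
    refine Submodule.span_le.2 ?_
    rintro _ ⟨_, ⟨ρ, hρ, rfl⟩, rfl⟩
    obtain ⟨τ, hτ, h⟩ := ht ρ hρ
    have hmem := mem_latticeCone_singleton (ρ : N)
    rw [h, latticeCone_singleton] at hmem
    exact (Submodule.span_le.2 (by simpa using htσ τ hτ) :
      PointedCone.hull ℚ {latticeIncl (τ : N)} ≤ σ) hmem
  refine S.face_mem σ hmax.prop _ ⟨hCσ, fun {x y a} hx hy ha hxy => ?_⟩
  -- On `σ` the function `φ` is linear and nonnegative, so its zero set there is a face.
  refine (hφ.nonneg_and_mem_of_eq_zero hS hD x).2 ?_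
  have h0 := hφ.eq_zero_of_mem_latticeCone hS hconv hnn hxy
  rw [hm _ (hCσ hxy), map_add, m.map_smul, smul_eq_mul, ← hm x hx, ← hm y hy] at h0
  have h1 : a * φ x = 0 := by linarith [hnn y, mul_nonneg ha.le (hnn x)]
  exact (mul_eq_zero.1 h1).resolve_left ha.ne'

/-! ### Fano nef partitions and the Gorenstein property. -/

theorem IsFanoNefPartition.setOf_divisorOf_eq_zero {r : ℕ} {E : Fin r → Set S.rays}
    {F : Set S.rays} (hEF : S.IsFanoNefPartition E F) :
    {ρ : S.rays | S.divisorOf F ρ = 0} = ⋃ i, E i := by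
  ext ρ
  have hcov : ρ ∈ (⋃ i, E i) ∪ F := hEF.cover ▸ Set.mem_univ ρ
  have hdisj : ρ ∈ ⋃ i, E i → ρ ∉ F := fun h => by
    obtain ⟨i, hi⟩ := Set.mem_iUnion.1 h
    exact Set.disjoint_left.1 (hEF.disjoint_F i) hi
  by_cases hF : ρ ∈ F
  · simpa [divisorOf, hF] using fun i hi => hdisj (Set.mem_iUnion.2 ⟨i, hi⟩) hF
  · simpa [divisorOf, hF] using hcov

theorem IsFanoNefPartition.sum_divisorOf_eq_one {r : ℕ} {E : Fin r → Set S.rays}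
    {F : Set S.rays} (hEF : S.IsFanoNefPartition E F) {ρ : S.rays} (hρ : ρ ∈ ⋃ i, E i) :
    ∑ i, S.divisorOf (E i) ρ = 1 := by
  obtain ⟨i, hi⟩ := Set.mem_iUnion.1 hρ
  rw [Finset.sum_eq_single i]
  · simp [divisorOf, hi]
  · intro j _ hj
    simp [divisorOf, Set.disjoint_left.1 (hEF.disjoint_E i j hj.symm) hi]
  · simp

end ToricFan

theorem mainTheorem7 {N : Type*} [AddCommGroup N] [Module.Free ℤ N] [Module.Finite ℤ N]
    (S : ToricFan N) (hS : S.IsComplete) {r : ℕ} (E : Fin r → Set S.rays) (F : Set S.rays)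
    (hEF : S.IsFanoNefPartition E F) :
    latticeCone ((↑) '' (⋃ i, E i) : Set N) ∈ S.cones ∧
      IsGorensteinCone (latticeCone ((↑) '' (⋃ i, E i) : Set N)) := by
  obtain ⟨φ, hφ, hconv, hstrict⟩ := hEF.ample_F
  have hD : ∀ ρ, 0 ≤ S.divisorOf F ρ := fun ρ => by
    unfold ToricFan.divisorOf
    split_ifs <;> norm_num
  have hC := ToricFan.latticeCone_mem_cones_of_isPLFunction hS hD hφ hconv hstrict
  have hzero : ∀ x ∈ latticeCone ((↑) '' {ρ : S.rays | S.divisorOf F ρ = 0} : Set N), φ x = 0 :=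
    fun x hx => hφ.eq_zero_of_mem_latticeCone hS hconv
      (fun x => (hφ.nonneg_and_mem_of_eq_zero hS hD x).1) hx
  rw [hEF.setOf_divisorOf_eq_zero] at hC hzero
  refine ⟨hC, S.polyhedral _ hC, S.stronglyConvex _ hC, ?_⟩
  choose m hm using fun i => (hEF.nef_E i).1 _ hC
  refine ⟨∑ i, m i, fun u hu hface => ?_⟩
  let ρ : S.rays := ⟨u, hu, S.face_mem _ hC _ hface⟩
  have huC := hface.le (mem_latticeCone_singleton u)
  -- `φ` vanishes on the cone, so the coefficient of `ρ` in `D_F` is zero and `ρ` cannot lie in `F`.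
  have hρ : ρ ∈ ⋃ i, E i := by
    rw [← hEF.setOf_divisorOf_eq_zero]
    have h := hφ.value ρ
    rw [hzero _ huC] at h
    exact_mod_cast h.symm
  rw [LinearMap.sum_apply, ← hEF.sum_divisorOf_eq_one hρ]
  exact Finset.sum_congr rfl fun i _ => hm i ρ huC
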